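/- Let $\mathcal{P}_O=\langle S,O,A,r,p,\omega,\gamma,\mu\rangle$ be a POMDP with finite sets $S$, $O$, $A$ of states, observations and actions, rewards $r(s,a,s')\in\mathbb{R}$, transition probabilities $p(s'\mid s,a)$, observation probabilities $\omega(o\mid s)$, discount factor $0\le\gamma<1$ and initial state distribution $\mu$ (terminal states, if any, are absorbing with reward $0$). A policy for $\mathcal{P}_O$ chooses $a_t$ at random from a distribution $\pi(\cdot\mid h_t)$ that may depend on the whole history $h_t=(o_0,a_0,\dots,a_{t-1},o_t)$ of observations and actions; it is optimal for $\mathcal{P}_O$ if it maximizes the expected return $\mathbb{E}_\pi\big[\sum_{t\ge 0}\gamma^t r(s_t,a_t,s_{t+1})\big]$ with $s_0\sim\mu$ among all such policies. Let $L:(O\cup\{\emptyset\})\times(A\cup\{\emptyset\})\times O\to 2^{\mathcal P}$ be a labelling function for a set $\mathcal P$ of propositional symbols, and let $\mathcal{R}=\langle U,u_0,\delta_u,\delta_r\rangle$ be a reward machine: a finite set $U$, $u_0\in U$, $\delta_u:U\times 2^{\mathcal P}\to U$ and $\delta_r:U\times 2^{\mathcal P}\to\mathbb{R}$. Its state along a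 history is $x_0=u_0$, $x_{t+1}=\delta_u(x_t,L(o_t,a_t,o_{t+1}))$. Write $r_t=r(s_t,a_t,s_{t+1})$. The reward machine is perfect for $\mathcal{P}_O$ with respect to $L$ if there are probabilities $\Pr(o',\rho\mid o,u,a)$, depending on nothing else, such that for every trace $(o_0,a_0,\dots,o_t,a_t)$ that has positive probability under some policy for $\mathcal{P}_O$, and all $o'\in O$, $\rho\in\mathbb{R}$, $$\Pr(o_{t+1}=o',\,r_t=\rho\mid o_0,a_0,\dots,o_t,a_t)=\Pr(o',\rho\mid o_t,x_t,a_t).$$ A policy $\pi(a\mid o,u)$ over $O\times U$ is run in $\mathcal{P}_O$ by choosing $a_t\sim\pi(\cdot\mid o_t,x_t)$; it is optimal for $\mathcal{R}$ with respect to the environment reward if it maximizes the expected return above among all policies over $O\times U$. If $\mathcal{R}$ is perfect for $\mathcal{P}_O$ with respect to $L$, then every policy over $O\times U$ that is optimal for $\mathcal{R}$ with respect to the environment reward is also optimal for $\mathcal{P}_O$. -/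

import Mathlib

open MeasureTheory ProbabilityTheory

/-- A partially observable Markov decision process with state space `S`, observation space `O` and
action space `A` (finite in all results).  The reward of a transition may depend on the state, the
action and the next state; a reward function `S → A → ℝ` is the special case in which the next
state is ignored.  Terminal states are absorbing states with reward zero. -/
structure POMDP (S O A : Type*) where
  /-- The reward `r(s, a, s')`. -/
  reward : S → A → S → ℝ
  /-- The transition distribution `p(· | s, a)`. -/
  trans : S → A → PMF S
  /-- The observation distribution `ω(· | s)`. -/
  obs : S → PMF O
  /-- The discount factor. -/
  discount : ℝ
  discount_nonneg : 0 ≤ discount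
  discount_lt_one : discount < 1
  /-- The distribution of the initial state. -/
  init : PMF S

/-- A reward machine with set of states `U` over the propositional symbols `P`.  A truth value
assignment of the symbols is the set of the true symbols. -/
structure RewardMachine (U P : Type*) where
  /-- The initial state `u₀`. -/
  start : U
  /-- The state-transition function `δ_u`. -/
  next : U → Set P → U
  /-- The reward-transition function `δ_r`. -/
  rew : U → Set P → ℝ

/-- A labelling function.  `none` stands for the missing previous observation and action at the
beginning of an episode. -/
abbrev LabellingFunction (O A P : Type*) := Option O → Option A → O → Set P

/-- A history `(o₀, a₀, o₁, …, a_{t-1}, o_t)` of observations and actions. -/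
inductive History (O A : Type*) where
  /-- The history `(o₀)`. -/
  | start (o : O) : History O A
  /-- The history `h` followed by the action `a` and the observation `o`. -/
  | step (h : History O A) (a : A) (o : O) : History O A

/-- The last observation `o_t` of a history. -/
def History.lastObs {O A : Type*} : History O A → O
  | .start o => o
  | .step _ _ o => o

/-- The state `x_t` of the reward machine after a history: `x₀ = u₀` and
`x_{t+1} = δ_u(x_t, L(o_t, a_t, o_{t+1}))`. -/
def RewardMachine.stateAfter {U P O A : Type*} (R : RewardMachine U P)
    (L : LabellingFunction O A P) : History O A → U
  | .start _ => R.start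
  | .step h a o => R.next (R.stateAfter L h) (L (some h.lastObs) (some a) o)

/-- A (stochastic, history-dependent) policy `π(a | o₀, a₀, …, o_t)`. -/
abbrev Policy (O A : Type*) := History O A → PMF A

/-- A (stochastic) policy `π(a | o, u)` over observations and states of a reward machine. -/
abbrev RMPolicy (O U A : Type*) := O → U → PMF A

/-- Running the policy `π(a | o, u)` together with the reward machine, as a policy of the POMDP:
`π(a | h_t) = π(a | o_t, x_t)`. -/
def RewardMachine.toPolicy {U P O A : Type*} (R : RewardMachine U P)
    (L : LabellingFunction O A P) (π : RMPolicy O U A) : Policy O A :=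
  fun h => π h.lastObs (R.stateAfter L h)

/-- What happens at one time step: the hidden state `s_t`, the observation `o_t` and the
action `a_t`. -/
@[ext]
structure Moment (S O A : Type*) where
  /-- The hidden state `s_t`. -/
  state : S
  /-- The observation `o_t`. -/
  obs : O
  /-- The action `a_t`. -/
  act : A

instance {S O A : Type*} : MeasurableSpace (Moment S O A) := ⊤

instance {S O A : Type*} : DiscreteMeasurableSpace (Moment S O A) := ⟨fun _ => trivial⟩

instance {S O A : Type*} [Finite S] [Finite O] [Finite A] : Finite (Moment S O A) :=
  Finite.of_injective (fun m : Moment S O A => (m.state, m.obs, m.act)) (by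
    rintro ⟨s, o, a⟩ ⟨s', o', a'⟩ h
    simpa using h)

/-- The history `(o₀, a₀, …, a_{t-1}, o_t)` of a trajectory at time `t`. -/
def historyAt {S O A : Type*} (x : ℕ → Moment S O A) : ℕ → History O A
  | 0 => .start (x 0).obs
  | t + 1 => .step (historyAt x t) (x t).act (x (t + 1)).obs

/-- The history at time `t` of a trajectory that is known up to time `t` only. -/
def historyOfPrefix {S O A : Type*} (t : ℕ) (x : (i : Finset.Iic t) → Moment S O A) :
    History O A :=
  historyAt (fun k => x ⟨min k t, Finset.mem_Iic.2 (min_le_right k t)⟩) t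

namespace POMDP

variable {S O A : Type*} (M : POMDP S O A)

/-- The joint law of `(s₀, o₀, a₀)`: `s₀ ∼ μ`, `o₀ ∼ ω(· | s₀)`, `a₀ ∼ π(· | o₀)`. -/
noncomputable def firstMoment (π : Policy O A) : PMF (Moment S O A) :=
  M.init.bind fun s => (M.obs s).bind fun o => (π (.start o)).map fun a => ⟨s, o, a⟩

/-- The joint law of `(s_{t+1}, o_{t+1}, a_{t+1})` given that at time `t` the history is `h`, the
state is `s` and the action is `a`. -/
noncomputable def nextMoment (π : Policy O A) (h : History O A) (s : S) (a : A) :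
    PMF (Moment S O A) :=
  (M.trans s a).bind fun s' => (M.obs s').bind fun o' =>
    (π (.step h a o')).map fun a' => ⟨s', o', a'⟩

variable [Finite S] [Finite O] [Finite A]

/-- The law of what happens at time `t + 1` given the trajectory up to time `t`. -/
noncomputable def stepKernel (π : Policy O A) (t : ℕ) :
    Kernel ((i : Finset.Iic t) → Moment S O A) (Moment S O A) :=
  Kernel.ofFunOfCountable fun x =>
    (M.nextMoment π (historyOfPrefix t x) (x ⟨t, Finset.mem_Iic.2 le_rfl⟩).state
      (x ⟨t, Finset.mem_Iic.2 le_rfl⟩).act).toMeasure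

instance (π : Policy O A) (t : ℕ) : IsMarkovKernel (M.stepKernel π t) :=
  ⟨fun _ => PMF.toMeasure.isProbabilityMeasure _⟩

/-- The law of the infinite trajectory `(s₀, o₀, a₀, s₁, o₁, a₁, …)` under the policy `π`. -/
noncomputable def law (π : Policy O A) : Measure (ℕ → Moment S O A) :=
  Kernel.trajMeasure (X := fun _ => Moment S O A) (M.firstMoment π).toMeasure (M.stepKernel π)

/-- The immediate reward `r(s_t, a_t, s_{t+1})` for the action at time `t`. -/
def rewardAt (x : ℕ → Moment S O A) (t : ℕ) : ℝ :=
  M.reward (x t).state (x t).act (x (t + 1)).state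

/-- The expected discounted return of a policy. -/
noncomputable def expectedReturn (π : Policy O A) : ℝ :=
  ∫ x, ∑' t : ℕ, M.discount ^ t * M.rewardAt x t ∂(M.law π)

/-- A policy is optimal for the POMDP if it maximizes the expected return among all
history-dependent policies. -/
def IsOptimal (π : Policy O A) : Prop :=
  ∀ π' : Policy O A, M.expectedReturn π' ≤ M.expectedReturn π

/-- A policy over observations and reward machine states is optimal with respect to the
environment reward if it maximizes the expected return among all such policies. -/
def IsOptimalRM {U P : Type*} (R : RewardMachine U P) (L : LabellingFunction O A P)
    (π : RMPolicy O U A) : Prop :=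
  ∀ π' : RMPolicy O U A,
    M.expectedReturn (R.toPolicy L π') ≤ M.expectedReturn (R.toPolicy L π)

/-- The event that the trace up to the action at time `t` is `(o₀, a₀, …, o_t, a_t)`, where
`h = (o₀, a₀, …, o_t)` and `a = a_t`. -/
def traceEvent (t : ℕ) (h : History O A) (a : A) : Set (ℕ → Moment S O A) :=
  {x | historyAt x t = h ∧ (x t).act = a}

/-- The event that the next observation is `o'` and that the immediate reward is `r`. -/
def outcomeEvent (t : ℕ) (o' : O) (r : ℝ) : Set (ℕ → Moment S O A) :=
  {x | (x (t + 1)).obs = o' ∧ M.rewardAt x t = r}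

/-- A reward machine is perfect for the POMDP with respect to the labelling function `L` if there
are probabilities `K o u a o' r`, playing the role of `Pr(o', r | o, u, a)`, such that for every
trace `(o₀, a₀, …, o_t, a_t)` generated by any policy the conditional probability of the next
observation and immediate reward given the trace is `Pr(o_{t+1}, r_t | o_t, x_t, a_t)`. -/
def IsPerfect {U P : Type*} (R : RewardMachine U P) (L : LabellingFunction O A P) : Prop :=
  ∃ K : O → U → A → O → ℝ → ENNReal,
    ∀ (π : Policy O A) (t : ℕ) (h : History O A) (a : A),
      M.law π (traceEvent t h a) ≠ 0 →
        ∀ (o' : O) (r : ℝ),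
          (M.law π)[M.outcomeEvent t o' r | traceEvent t h a] =
            K h.lastObs (R.stateAfter L h) a o' r

end POMDP

/-!
If the reward machine is perfect, the pairs `z_t = (o_t, x_t)` of the last observation and the state
of the machine form a fully observable finite Markov decision process: given any trace
`(o₀, a₀, …, o_t, a_t)`, the next observation and the reward, hence also `z_{t+1}`, have a law that
depends on `z_t` and `a_t` only.  The Bellman operator of this process is a `γ`-contraction; its
fixed point `V` and a greedy choice of actions `α` are given by `exists_optimality_equation`.

Under every history-dependent policy `E[r_t + γ V(z_{t+1})] ≤ E[V(z_t)]`, and under the stationary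
policy `α` equality holds (`POMDP.IsPerfect.exists_value`); this is checked on each of the finitely
many traces of length `t`.  Multiplying by `γ ^ t` and summing (`POMDP.hasSum_gain`), the return of
every policy is at most `E[V(z₀)]`, and that of `α` is at least `E[V(z₀)]`.  The number `E[V(z₀)]` is
the same for all policies, as the law of `o₀` is (`POMDP.integral_obs_zero_eq`).  So the policy `α`
over `O × U` is at least as good as every history-dependent one, and an optimal policy over `O × U`
is at least as good as `α`.
-/

/-! ### Histories -/

theorem historyAt_congr {S O A : Type*} {x y : ℕ → Moment S O A} {t : ℕ}
    (h : ∀ i ≤ t, x i = y i) : historyAt x t = historyAt y t := by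
  induction t with
  | zero => simp [historyAt, h 0 le_rfl]
  | succ t ih =>
    simp [historyAt, h t (Nat.le_succ t), h (t + 1) le_rfl, ih fun i hi => h i (by omega)]

theorem historyOfPrefix_frestrictLe {S O A : Type*} (x : ℕ → Moment S O A) (t : ℕ) :
    historyOfPrefix t (Preorder.frestrictLe t x) = historyAt x t :=
  historyAt_congr fun i hi => by simp [min_eq_left hi]

theorem lastObs_historyAt {S O A : Type*} (x : ℕ → Moment S O A) (t : ℕ) :
    (historyAt x t).lastObs = (x t).obs := by
  cases t <;> rfl

/-! ### Functions of finitely many moments -/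

section DependsOn

variable {S O A β : Type*} {f : (ℕ → Moment S O A) → β} {n : ℕ}

theorem DependsOn.exists_eq_comp_frestrictLe (hf : DependsOn f (Set.Iic n)) :
    ∃ g, f = g ∘ Preorder.frestrictLe (π := fun _ => Moment S O A) n :=
  ⟨fun p => f fun k => p ⟨min k n, Finset.mem_Iic.2 (min_le_right k n)⟩,
    funext fun x => hf fun i hi => by simp [min_eq_left (Set.mem_Iic.1 hi)]⟩

variable [Finite S] [Finite O] [Finite A]

theorem DependsOn.finite_range (hf : DependsOn f (Set.Iic n)) : (Set.range f).Finite := by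
  obtain ⟨g, rfl⟩ := hf.exists_eq_comp_frestrictLe
  exact (Set.finite_range g).subset (Set.range_comp_subset_range _ _)

/-- Moments range over a finite discrete type, so a function of finitely many of them is measurable
for every σ-algebra on its codomain. -/
theorem DependsOn.measurable_of_finite [MeasurableSpace β] (hf : DependsOn f (Set.Iic n)) :
    Measurable f := by
  obtain ⟨g, rfl⟩ := hf.exists_eq_comp_frestrictLe
  exact (Measurable.of_discrete (f := g)).comp (Preorder.measurable_frestrictLe n)

theorem DependsOn.integrable_of_finite {f : (ℕ → Moment S O A) → ℝ} (hf : DependsOn f (Set.Iic n))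
    (μ : Measure (ℕ → Moment S O A)) [IsFiniteMeasure μ] : Integrable f μ := by
  obtain ⟨C, hC⟩ := hf.finite_range.isBounded.exists_norm_le
  exact Integrable.of_bound hf.measurable_of_finite.aestronglyMeasurable C
    (ae_of_all _ fun x => hC _ ⟨x, rfl⟩)

end DependsOn

theorem dependsOn_trace {S O A : Type*} (t : ℕ) :
    DependsOn (fun x : ℕ → Moment S O A => (historyAt x t, (x t).act)) (Set.Iic t) :=
  fun x y h => by simp [historyAt_congr h, h t (Set.mem_Iic.2 le_rfl)]

namespace POMDP

variable {S O A : Type*} (M : POMDP S O A)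

theorem dependsOn_rewardAt (t : ℕ) :
    DependsOn (fun x => M.rewardAt x t) (Set.Iic (t + 1)) :=
  fun x y h => by
    simp [rewardAt, h t (Set.mem_Iic.2 (Nat.le_succ t)), h (t + 1) (Set.mem_Iic.2 le_rfl)]

variable [Finite S] [Finite O] [Finite A]

theorem measurableSet_traceEvent (t : ℕ) (h : History O A) (a : A) :
    MeasurableSet (traceEvent (S := S) t h a) := by
  let _ : MeasurableSpace (History O A × A) := ⊤
  have : traceEvent (S := S) t h a = (fun x => (historyAt x t, (x t).act)) ⁻¹' {(h, a)} := by
    ext x; simp [traceEvent]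
  rw [this]
  exact (dependsOn_trace t).measurable_of_finite trivial

/-! ### The law of a trajectory -/

instance (π : Policy O A) : IsProbabilityMeasure (M.law π) := by
  have : IsProbabilityMeasure (M.firstMoment π).toMeasure :=
    PMF.toMeasure.isProbabilityMeasure _
  unfold law
  infer_instance

theorem law_map_zero (π : Policy O A) :
    (M.law π).map (fun x => x 0) = (M.firstMoment π).toMeasure := by
  let e := MeasurableEquiv.piUnique fun _ : Finset.Iic 0 => Moment S O A
  have h1 : (fun x : ℕ → Moment S O A => x 0) = e ∘ Preorder.frestrictLe 0 := by
    funext x; rfl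
  have h2 : (M.law π).map (Preorder.frestrictLe (π := fun _ => Moment S O A) 0)
      = (M.firstMoment π).toMeasure.map e.symm := by
    rw [law, Kernel.trajMeasure, Measure.map_comp _ _ (by fun_prop), Kernel.traj_map_frestrictLe,
      Kernel.partialTraj_self, Measure.id_comp]
  rw [h1, ← Measure.map_map (by fun_prop) (by fun_prop), h2,
    Measure.map_map (by fun_prop) (by fun_prop)]
  simp

/-- A policy only takes actions to which it gives positive probability. -/
theorem ae_act_mem_support (π : Policy O A) (t : ℕ) :
    ∀ᵐ x ∂M.law π, (x t).act ∈ (π (historyAt x t)).support := by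
  have key : ∀ p : PMF (Moment S O A), ∀ᵐ m ∂p.toMeasure, m ∈ p.support := fun p => by
    rw [ae_iff, PMF.toMeasure_apply_eq_zero_iff _ (MeasurableSet.of_discrete)]
    exact Set.disjoint_left.2 fun m hm h => h hm
  cases t with
  | zero =>
    have h : ∀ᵐ m ∂(M.law π).map (fun x => x 0), m.act ∈ (π (.start m.obs)).support := by
      rw [law_map_zero]
      filter_upwards [key _] with m hm
      simp only [firstMoment, PMF.mem_support_bind_iff, PMF.mem_support_map_iff] at hm
      obtain ⟨s, -, o, -, a, ha, rfl⟩ := hm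
      exact ha
    exact ae_of_ae_map (measurable_pi_apply 0).aemeasurable h
  | succ t =>
    have : IsProbabilityMeasure (M.firstMoment π).toMeasure :=
      PMF.toMeasure.isProbabilityMeasure _
    have h : ∀ᵐ q ∂(M.law π).map (fun x => (Preorder.frestrictLe t x, x (t + 1))),
        q.2.act ∈ (π (.step (historyOfPrefix t q.1)
          (q.1 ⟨t, Finset.mem_Iic.2 le_rfl⟩).act q.2.obs)).support := by
      rw [law, ← Kernel.map_frestrictLe_trajMeasure_compProd_eq_map_trajMeasure]
      refine Measure.ae_compProd_of_ae_ae MeasurableSet.of_discrete (ae_of_all _ fun p => ?_)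
      have hp : ∀ᵐ m ∂M.stepKernel π t p, m ∈ _ := key _
      filter_upwards [hp] with m hm
      simp only [nextMoment, PMF.mem_support_bind_iff, PMF.mem_support_map_iff] at hm
      obtain ⟨s, -, o, -, a, ha, rfl⟩ := hm
      exact ha
    filter_upwards [ae_of_ae_map (by fun_prop) h] with x hx
    rwa [historyOfPrefix_frestrictLe] at hx

/-- The law of the initial observation is the same for all policies. -/
theorem integral_obs_zero_eq (π π' : Policy O A) (f : O → ℝ) :
    ∫ x, f (x 0).obs ∂M.law π = ∫ x, f (x 0).obs ∂M.law π' := by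
  let _ : MeasurableSpace O := ⊤
  have h : ∀ π : Policy O A,
      ∫ x, f (x 0).obs ∂M.law π = ∫ o, f o ∂(M.init.bind M.obs).toMeasure := fun π => by
    have hp : (M.firstMoment π).map Moment.obs = M.init.bind M.obs := by
      have hc : ∀ (o : O) (p : PMF A), p.map (fun _ => o) = PMF.pure o := fun o p => p.map_const o
      simp [firstMoment, PMF.map_bind, PMF.map_comp, Function.comp_def, hc, PMF.bind_pure]
    have hm : Measurable fun x : ℕ → Moment S O A => x 0 := measurable_pi_apply 0
    have ho : Measurable (Moment.obs : Moment S O A → O) := Measurable.of_discrete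
    rw [← hp, ← PMF.toMeasure_map _ _ ho, ← law_map_zero, Measure.map_map ho hm,
      integral_map (ho.comp hm).aemeasurable Measurable.of_discrete.aestronglyMeasurable]
    rfl
  rw [h, h]

end POMDP

/-! ### Finite discounted decision processes -/

/-- The optimality equation of a finite discounted decision process with states `Z`, actions `A` and
outcomes `Y`: the value `V` is the fixed point of the Bellman operator and `α` is greedy for `V`.
The weights `w` of the outcomes need only be subprobabilities. -/
theorem exists_optimality_equation {Z A Y : Type*} [Finite Z] [Finite A] [Nonempty A] [Fintype Y]
    {γ : ℝ} (hγ0 : 0 ≤ γ) (hγ1 : γ < 1) (w : Z → A → Y → ℝ) (hw : ∀ z a y, 0 ≤ w z a y)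
    (hw1 : ∀ z a, ∑ y, w z a y ≤ 1) (ρ : Z → A → Y → ℝ) (nx : Z → A → Y → Z) :
    ∃ (V : Z → ℝ) (α : Z → A),
      (∀ z a, ∑ y, w z a y * (ρ z a y + γ * V (nx z a y)) ≤ V z) ∧
      ∀ z, ∑ y, w z (α z) y * (ρ z (α z) y + γ * V (nx z (α z) y)) = V z := by
  have := Fintype.ofFinite Z
  let q : (Z → ℝ) → Z → A → ℝ := fun V z a => ∑ y, w z a y * (ρ z a y + γ * V (nx z a y))
  let T : (Z → ℝ) → Z → ℝ := fun V z => ⨆ a, q V z a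
  have hq : ∀ V W z a, q V z a ≤ q W z a + γ * dist V W := fun V W z a => by
    have : q V z a - q W z a ≤ γ * dist V W := by
      calc q V z a - q W z a = ∑ y, w z a y * (γ * (V (nx z a y) - W (nx z a y))) := by
            simp only [q, ← Finset.sum_sub_distrib]
            exact Finset.sum_congr rfl fun y _ => by ring
        _ ≤ ∑ y, w z a y * (γ * dist V W) := by
            gcongr with y _
            · exact hw z a y
            · exact (le_abs_self _).trans (dist_le_pi_dist V W _)
        _ = (∑ y, w z a y) * (γ * dist V W) := by rw [Finset.sum_mul]
        _ ≤ 1 * (γ * dist V W) := by gcongr; exact hw1 z a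
        _ = γ * dist V W := one_mul _
    linarith
  have hle : ∀ V z a, q V z a ≤ T V z := fun V z a => le_ciSup (Set.finite_range (q V z)).bddAbove a
  have hT1 : ∀ V W z, T V z ≤ T W z + γ * dist V W := fun V W z =>
    ciSup_le fun a => (hq V W z a).trans (by gcongr; exact hle W z a)
  have hT : ContractingWith ⟨γ, hγ0⟩ T := by
    refine ⟨hγ1, LipschitzWith.of_dist_le_mul fun V W => ?_⟩
    refine (dist_pi_le_iff (by positivity)).2 fun z => ?_
    rw [Real.dist_eq, abs_le]
    have h1 := hT1 V W z
    have h2 := hT1 W V z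
    rw [dist_comm] at h2
    change -(γ * dist V W) ≤ T V z - T W z ∧ T V z - T W z ≤ γ * dist V W
    constructor <;> linarith
  have hfix : T hT.fixedPoint = hT.fixedPoint := hT.fixedPoint_isFixedPt
  choose α hα using fun z => exists_eq_ciSup_of_finite (f := q hT.fixedPoint z)
  refine ⟨hT.fixedPoint, α, fun z a => ?_, fun z => ?_⟩
  · exact (hle _ z a).trans_eq (congrFun hfix z)
  · exact (hα z).trans (congrFun hfix z)

namespace POMDP

/-! ### Return, one-step gains and the contribution of a trace -/

variable {S O A : Type*} (M : POMDP S O A)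

/-- The set of the possible immediate rewards. -/
def rewardValues : Set ℝ := Set.range fun q : S × A × S => M.reward q.1 q.2.1 q.2.2

theorem rewardAt_mem_rewardValues (x : ℕ → Moment S O A) (t : ℕ) :
    M.rewardAt x t ∈ M.rewardValues :=
  ⟨((x t).state, (x t).act, (x (t + 1)).state), rfl⟩

variable [Finite S] [Finite O] [Finite A]

instance : Finite M.rewardValues := (Set.finite_range _).to_subtype

theorem integrable_rewardAt (π : Policy O A) (t : ℕ) :
    Integrable (fun x => M.rewardAt x t) (M.law π) :=
  (M.dependsOn_rewardAt t).integrable_of_finite _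

/-- The rewards are bounded, so that the expectation of the return is the discounted sum of the
expected immediate rewards. -/
theorem hasSum_expectedReturn (π : Policy O A) :
    HasSum (fun t => M.discount ^ t * ∫ x, M.rewardAt x t ∂M.law π) (M.expectedReturn π) := by
  obtain ⟨C, hC⟩ := (Set.toFinite M.rewardValues).isBounded.exists_norm_le
  have h := hasSum_integral_of_summable_integral_norm (μ := M.law π)
    (F := fun t x => M.discount ^ t * M.rewardAt x t)
    (fun t => (M.integrable_rewardAt π t).const_mul _) ?_
  · simp only [integral_const_mul] at h
    exact h
  · refine Summable.of_nonneg_of_le (fun t => integral_nonneg fun x => norm_nonneg _) (fun t => ?_)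
      ((summable_geometric_of_lt_one M.discount_nonneg M.discount_lt_one).mul_right C)
    calc ∫ x, ‖M.discount ^ t * M.rewardAt x t‖ ∂M.law π
        ≤ ∫ _, M.discount ^ t * C ∂M.law π := by
          refine integral_mono ((M.integrable_rewardAt π t).const_mul _).norm
            (integrable_const _) fun x => ?_
          rw [norm_mul, norm_pow, Real.norm_of_nonneg M.discount_nonneg]
          exact mul_le_mul_of_nonneg_left (hC _ (M.rewardAt_mem_rewardValues x t))
            (pow_nonneg M.discount_nonneg t)
      _ = M.discount ^ t * C := by simp

/-- The return is the value at time `0` plus the discounted sum of the one-step gains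
`r_t + γ v_{t+1} - v_t`, whatever the bounded sequence `v`. -/
theorem hasSum_gain (π : Policy O A) (v : ℕ → ℝ) {C : ℝ} (hv : ∀ t, |v t| ≤ C) :
    HasSum (fun t => M.discount ^ t *
      ((∫ x, M.rewardAt x t ∂M.law π) + M.discount * v (t + 1) - v t))
      (M.expectedReturn π - v 0) := by
  have hs : Summable fun t => M.discount ^ t * v t := by
    refine Summable.of_norm_bounded
      ((summable_geometric_of_lt_one M.discount_nonneg M.discount_lt_one).mul_right C) fun t => ?_
    rw [norm_mul, norm_pow, Real.norm_of_nonneg M.discount_nonneg]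
    exact mul_le_mul_of_nonneg_left (hv t) (pow_nonneg M.discount_nonneg t)
  have h1 := (hasSum_nat_add_iff' 1).2 hs.hasSum
  have h2 := ((M.hasSum_expectedReturn π).add h1).sub hs.hasSum
  have hval : M.expectedReturn π - v 0 = M.expectedReturn π + ((∑' t, M.discount ^ t * v t) -
      ∑ t ∈ Finset.range 1, M.discount ^ t * v t) - ∑' t, M.discount ^ t * v t := by
    rw [Finset.sum_range_one, pow_zero]
    ring
  rw [hval]
  refine (congrArg (fun F : ℕ → ℝ => HasSum F _) (funext fun t => ?_)).mpr h2
  ring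

/-- To compare two expectations it suffices to compare the contributions of each trace. -/
theorem integral_mono_of_traceEvent (π : Policy O A) (t : ℕ) {f g : (ℕ → Moment S O A) → ℝ}
    (hf : Integrable f (M.law π)) (hg : Integrable g (M.law π))
    (h : ∀ h a, ∫ x in traceEvent t h a, f x ∂M.law π ≤ ∫ x in traceEvent t h a, g x ∂M.law π) :
    ∫ x, f x ∂M.law π ≤ ∫ x, g x ∂M.law π := by
  let tr : (ℕ → Moment S O A) → History O A × A := fun x => (historyAt x t, (x t).act)
  have := (dependsOn_trace (S := S) (O := O) (A := A) t).finite_range.fintype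
  let E : Set.range tr → Set (ℕ → Moment S O A) := fun i => traceEvent t i.1.1 i.1.2
  have hE : ⋃ i, E i = Set.univ :=
    Set.eq_univ_of_forall fun x => Set.mem_iUnion.2 ⟨⟨tr x, x, rfl⟩, rfl, rfl⟩
  have hm : ∀ i, MeasurableSet (E i) := fun i => measurableSet_traceEvent t _ _
  have hd : Pairwise (Function.onFun Disjoint E) := fun i j hij =>
    Set.disjoint_left.2 fun x hi hj => hij <| Subtype.ext <| Prod.ext
      (hi.1.symm.trans hj.1) (hi.2.symm.trans hj.2)
  rw [← setIntegral_univ (f := f), ← setIntegral_univ (f := g), ← hE,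
    integral_iUnion_fintype hm hd fun i => hf.integrableOn,
    integral_iUnion_fintype hm hd fun i => hg.integrableOn]
  exact Finset.sum_le_sum fun i _ => h _ _

/-- The contribution of a trace to the expectation of a function of the next observation and the
immediate reward. -/
theorem setIntegral_traceEvent (π : Policy O A) (t : ℕ) (h : History O A) (a : A)
    [Fintype (O × M.rewardValues)] {K : O → ℝ → ENNReal}
    (h0 : M.law π (traceEvent t h a) ≠ 0)
    (hK : ∀ o r, (M.law π)[M.outcomeEvent t o r | traceEvent t h a] = K o r) (f : O → ℝ → ℝ) :
    ∫ x in traceEvent t h a, f (x (t + 1)).obs (M.rewardAt x t) ∂M.law π =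
      (M.law π).real (traceEvent t h a) *
        ∑ y : O × M.rewardValues, (K y.1 y.2).toReal * f y.1 y.2 := by
  let _ : MeasurableSpace (O × M.rewardValues) := ⊤
  let Y : (ℕ → Moment S O A) → O × M.rewardValues := fun x =>
    ((x (t + 1)).obs, ⟨M.rewardAt x t, M.rewardAt_mem_rewardValues x t⟩)
  have hY : Measurable Y := DependsOn.measurable_of_finite (n := t + 1) fun x y hxy => by
    simp [Y, hxy (t + 1) (Set.mem_Iic.2 le_rfl), M.dependsOn_rewardAt t hxy]
  have hYe : ∀ y : O × M.rewardValues, Y ⁻¹' {y} = M.outcomeEvent t y.1 y.2 := fun y => by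
    ext x
    simp [Y, outcomeEvent, Prod.ext_iff, Subtype.ext_iff]
  have hw : ∀ y : O × M.rewardValues, ((M.law π).restrict (traceEvent t h a)).real (Y ⁻¹' {y}) =
      (M.law π).real (traceEvent t h a) * (K y.1 y.2).toReal := fun y => by
    rw [← hK, cond_apply (measurableSet_traceEvent t h a), hYe, measureReal_def,
      Measure.restrict_apply (hYe y ▸ hY trivial), ENNReal.toReal_mul, ENNReal.toReal_inv,
      measureReal_def, Set.inter_comm, mul_inv_cancel_left₀]
    exact ENNReal.toReal_ne_zero.2 ⟨h0, measure_ne_top _ _⟩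
  calc ∫ x in traceEvent t h a, f (x (t + 1)).obs (M.rewardAt x t) ∂M.law π
      = ∫ y, f y.1 y.2 ∂((M.law π).restrict (traceEvent t h a)).map Y :=
        (integral_map (f := fun y : O × M.rewardValues => f y.1 y.2) hY.aemeasurable
          Measurable.of_discrete.aestronglyMeasurable).symm
    _ = _ := by
        rw [integral_fintype .of_finite, Finset.mul_sum]
        refine Finset.sum_congr rfl fun y _ => ?_
        rw [map_measureReal_apply hY trivial, hw, smul_eq_mul, mul_assoc]

/-! ### The value function of a perfect reward machine -/

/-- A perfect reward machine turns the POMDP into a fully observable decision process over the pairs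
`z_t = (o_t, x_t)`: there are a value function `V` and a greedy choice of actions `α` such that
`E[r_t + γ V(z_{t+1})] ≤ E[V(z_t)]` for all history-dependent policies, with equality for `α`. -/
theorem IsPerfect.exists_value {U P : Type*} [Finite U] [Nonempty A] {M : POMDP S O A}
    {R : RewardMachine U P} {L : LabellingFunction O A P} (hR : M.IsPerfect R L) :
    ∃ (V : O → U → ℝ) (α : O → U → A),
      (∀ (π : Policy O A) (t : ℕ),
        ∫ x, M.rewardAt x t + M.discount *
            V (x (t + 1)).obs (R.stateAfter L (historyAt x (t + 1))) ∂M.law π ≤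
          ∫ x, V (x t).obs (R.stateAfter L (historyAt x t)) ∂M.law π) ∧
      ∀ t, ∫ x, V (x t).obs (R.stateAfter L (historyAt x t))
            ∂M.law (R.toPolicy L fun o u => PMF.pure (α o u)) ≤
          ∫ x, M.rewardAt x t + M.discount *
            V (x (t + 1)).obs (R.stateAfter L (historyAt x (t + 1)))
            ∂M.law (R.toPolicy L fun o u => PMF.pure (α o u)) := by
  classical
  obtain ⟨K, hK⟩ := hR
  have := Fintype.ofFinite (O × M.rewardValues)
  -- Nothing is known of `K` at triples which no trace reaches: there it is replaced by `0`.
  let w : O × U → A → O × M.rewardValues → ℝ := fun z a y =>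
    if ∑ y : O × M.rewardValues, (K z.1 z.2 a y.1 y.2).toReal ≤ 1 then
      (K z.1 z.2 a y.1 y.2).toReal else 0
  obtain ⟨V, α, hle, heq⟩ := exists_optimality_equation M.discount_nonneg M.discount_lt_one w
    (fun z a y => by dsimp only [w]; split_ifs <;> simp)
    (fun z a => by
      dsimp only [w]; split_ifs with h
      · exact h
      · simp)
    (fun z a y => y.2) (fun z a y => (y.1, R.next z.2 (L (some z.1) (some a) y.1)))
  let f : (ℕ → Moment S O A) → ℕ → ℝ := fun x t => M.rewardAt x t + M.discount *
    V ((x (t + 1)).obs, R.stateAfter L (historyAt x (t + 1)))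
  let g : (ℕ → Moment S O A) → ℕ → ℝ := fun x t => V ((x t).obs, R.stateAfter L (historyAt x t))
  have hf : ∀ (π : Policy O A) (t : ℕ), Integrable (fun x => f x t) (M.law π) := fun π t =>
    DependsOn.integrable_of_finite (n := t + 1) (fun x y h => by
      simp [f, historyAt_congr h, M.dependsOn_rewardAt t h, h (t + 1) (Set.mem_Iic.2 le_rfl)]) _
  have hg : ∀ (π : Policy O A) (t : ℕ), Integrable (fun x => g x t) (M.law π) := fun π t =>
    DependsOn.integrable_of_finite (n := t) (fun x y h => by
      simp [g, historyAt_congr h, h t (Set.mem_Iic.2 le_rfl)]) _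
  have hgE : ∀ (π : Policy O A) (t : ℕ) (h : History O A) (a : A),
      ∫ x in traceEvent t h a, g x t ∂M.law π =
        (M.law π).real (traceEvent t h a) * V (h.lastObs, R.stateAfter L h) := fun π t h a => by
    rw [setIntegral_congr_fun (g := fun _ => V (h.lastObs, R.stateAfter L h))
      (measurableSet_traceEvent t h a) fun x hx => ?_]
    · simp
    · simp only [g]
      rw [← lastObs_historyAt, hx.1]
  have hfE : ∀ (π : Policy O A) (t : ℕ) (h : History O A) (a : A),
      M.law π (traceEvent t h a) ≠ 0 → ∫ x in traceEvent t h a, f x t ∂M.law π =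
        (M.law π).real (traceEvent t h a) * ∑ y : O × M.rewardValues,
          w (h.lastObs, R.stateAfter L h) a y * (y.2 + M.discount *
            V (y.1, R.next (R.stateAfter L h) (L (some h.lastObs) (some a) y.1))) := by
    intro π t h a h0
    have hK' := hK π t h a h0
    have hp : (M.law π).real (traceEvent t h a) ≠ 0 :=
      ENNReal.toReal_ne_zero.2 ⟨h0, measure_ne_top _ _⟩
    have hsum : ∑ y : O × M.rewardValues,
        (K h.lastObs (R.stateAfter L h) a y.1 y.2).toReal = 1 := by
      have := M.setIntegral_traceEvent π t h a h0 hK' fun _ _ => 1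
      simp only [integral_const, smul_eq_mul, mul_one, measureReal_restrict_apply_univ] at this
      exact (mul_left_cancel₀ hp (by rw [← this, mul_one])).symm
    have hw : ∀ y, w (h.lastObs, R.stateAfter L h) a y =
        (K h.lastObs (R.stateAfter L h) a y.1 y.2).toReal := fun y => if_pos hsum.le
    simp only [hw]
    rw [← M.setIntegral_traceEvent π t h a h0 hK' fun o r => r + M.discount *
      V (o, R.next (R.stateAfter L h) (L (some h.lastObs) (some a) o))]
    refine setIntegral_congr_fun (measurableSet_traceEvent t h a) fun x hx => ?_
    simp only [f, historyAt, RewardMachine.stateAfter]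
    rw [hx.1, hx.2]
  refine ⟨fun o u => V (o, u), fun o u => α (o, u), fun π t => ?_, fun t => ?_⟩
  · refine M.integral_mono_of_traceEvent π t (hf π t) (hg π t) fun h a => ?_
    by_cases h0 : M.law π (traceEvent t h a) = 0
    · rw [setIntegral_measure_zero _ h0, setIntegral_measure_zero _ h0]
    · rw [hfE π t h a h0, hgE]
      exact mul_le_mul_of_nonneg_left (hle _ a) measureReal_nonneg
  · set π := R.toPolicy L fun o u => PMF.pure (α (o, u))
    refine M.integral_mono_of_traceEvent π t (hg π t) (hf π t) fun h a => ?_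
    by_cases h0 : M.law π (traceEvent t h a) = 0
    · rw [setIntegral_measure_zero _ h0, setIntegral_measure_zero _ h0]
    · obtain rfl : a = α (h.lastObs, R.stateAfter L h) := by
        by_contra ha
        have hsub : traceEvent (S := S) t h a ⊆
            {x | ¬(x t).act ∈ (π (historyAt x t)).support} := by
          rintro x ⟨rfl, rfl⟩ hs
          exact ha ((PMF.mem_support_pure_iff _ _).1 hs)
        exact h0 (measure_mono_null hsub (ae_iff.1 (M.ae_act_mem_support π t)))
      rw [hfE π t h _ h0, hgE, heq]

end POMDP

theorem theorem2 {S O A U P : Type*} [Finite S] [Finite O] [Finite A] [Finite U]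
    (M : POMDP S O A) (R : RewardMachine U P) (L : LabellingFunction O A P)
    (hR : M.IsPerfect R L) (π : RMPolicy O U A) (hπ : M.IsOptimalRM R L π) :
    M.IsOptimal (R.toPolicy L π) := by
  intro π'
  obtain ⟨x⟩ := nonempty_of_isProbabilityMeasure (M.law π')
  have : Nonempty A := ⟨(x 0).act⟩
  obtain ⟨V, α, hle, hge⟩ := hR.exists_value
  let v : Policy O A → ℕ → ℝ := fun σ t =>
    ∫ x, V (x t).obs (R.stateAfter L (historyAt x t)) ∂M.law σ
  obtain ⟨C, hC⟩ := (Set.finite_range fun z : O × U => V z.1 z.2).isBounded.exists_norm_le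
  have hv : ∀ σ t, |v σ t| ≤ C := fun σ t => by
    simpa using norm_integral_le_of_norm_le_const (μ := M.law σ)
      (ae_of_all _ fun x => hC _ ⟨((x t).obs, R.stateAfter L (historyAt x t)), rfl⟩)
  have hsplit : ∀ σ t, ∫ x, M.rewardAt x t + M.discount *
      V (x (t + 1)).obs (R.stateAfter L (historyAt x (t + 1))) ∂M.law σ =
      (∫ x, M.rewardAt x t ∂M.law σ) + M.discount * v σ (t + 1) := fun σ t => by
    rw [integral_add (M.integrable_rewardAt σ t), integral_const_mul]
    refine Integrable.const_mul (DependsOn.integrable_of_finite (n := t + 1) (fun x y h => ?_) _) _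
    simp [historyAt_congr h, h (t + 1) (Set.mem_Iic.2 le_rfl)]
  let σ : RMPolicy O U A := fun o u => PMF.pure (α o u)
  have h1 : M.expectedReturn π' - v π' 0 ≤ 0 :=
    (M.hasSum_gain π' (v π') (hv π')).nonpos fun t =>
      mul_nonpos_of_nonneg_of_nonpos (pow_nonneg M.discount_nonneg t)
        (sub_nonpos.2 (hsplit π' t ▸ hle π' t))
  have h2 : 0 ≤ M.expectedReturn (R.toPolicy L σ) - v (R.toPolicy L σ) 0 :=
    (M.hasSum_gain _ (v _) (hv _)).nonneg fun t =>
      mul_nonneg (pow_nonneg M.discount_nonneg t) (sub_nonneg.2 (hsplit _ t ▸ hge t))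
  have h0 : v π' 0 = v (R.toPolicy L σ) 0 :=
    M.integral_obs_zero_eq _ _ fun o => V o R.start
  linarith [hπ σ]
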